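/- An \emph{ai-semiring} is a nonempty algebra $(S,+,\cdot)$ such that $(S,+)$ is a commutative idempotent semigroup, $(S,\cdot)$ is a semigroup, and multiplication distributes over addition on both sides; its order is given by $x\le y \iff x+y=y$. A \emph{variety} is a class of ai-semirings closed under subalgebras, homomorphic images and arbitrary direct products; $\mathsf V(A)$ is the smallest variety containing $A$, and $\mathbf T$ is the variety of one-element ai-semirings. Let $SR_6$ be the ai-semiring on $\{1,\dots,6\}$ with commutative operations in which $i+i=i$ for all $i$, $2+5=2$, $4+6=4$, and all other sums of two distinct elements are $1$; $2\cdot 6=4\cdot 5=5\cdot 6=3$, and all other products are $1$. For a commutative word $w$, let $S_c(w)$ be the set of nonempty subwords of $w$ together with a new symbol $0$, where $u+v=u$ if $u=v$ and $u+v=0$ otherwise, and where $u\cdot v$ is the word $uv$ if $u,v$ are words and $uv$ is a subword of $w$, and $0$ otherwise. Let $a,b$ be distinct letters. \textbf{Proposition.} The subvarieties of $\mathsf V(SR_6)$, ordered by inclusion, form the four-element chain $$\mathbf T\subset \mathsf V(S_c(a))\subset \mathsf V(S_c(ab))\subset \mathsf V(SR_6).$$ Moreover: 1. $\mathsf V(S_c(a))$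 is the unique minimal nontrivial subvariety of $\mathsf V(SR_6)$. 2. Within $\mathsf V(SR_6)$, the variety $\mathsf V(S_c(a))$ is defined by the identity $x^2\approx xy$, and $\mathsf V(S_c(ab))$ is defined by the inequality $x_1x_4\le x_1x_2+x_2x_3+x_3x_4$. 3. If $S\in\mathsf V(SR_6)$ and $p,q\in S$ satisfy $p^2\ne pq$, then there is a homomorphism from the subalgebra $\langle p,q\rangle$ onto $S_c(ab)$ with $p\mapsto a$ and $q\mapsto b$. 4. If $S\in\mathsf V(SR_6)$ and $p,q,r,s\in S$ satisfy $ps\not\le pq+qr+rs$, then the subalgebra $\langle p,q,r,s\rangle$ has at most $86$ elements, and there is a homomorphism from it onto $SR_6$ with $p\mapsto 2$, $q\mapsto 6$, $r\mapsto 5$, $s\mapsto 4$. -/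

import Mathlib

/-- An additively idempotent semiring (ai-semiring): `(S, +)` is a commutative idempotent
semigroup, `(S, *)` is a semigroup, and both distributive laws hold. No additive or
multiplicative neutral element is required. -/
class AISemiring (S : Type*) extends AddCommSemigroup S, Semigroup S, Distrib S where
  add_idem : ∀ a : S, a + a = a

/-- Homomorphisms of ai-semirings. -/
structure AIHom (S T : Type*) [AISemiring S] [AISemiring T] where
  toFun : S → T
  map_add : ∀ x y, toFun (x + y) = toFun x + toFun y
  map_mul : ∀ x y, toFun (x * y) = toFun x * toFun y

instance (S T : Type*) [AISemiring S] [AISemiring T] : CoeFun (AIHom S T) (fun _ => S → T) :=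
  ⟨AIHom.toFun⟩

/-- Subsets of an ai-semiring that are closed under both operations. -/
@[ext]
structure AISub (S : Type*) [AISemiring S] where
  carrier : Set S
  add_mem : ∀ {x y}, x ∈ carrier → y ∈ carrier → x + y ∈ carrier
  mul_mem : ∀ {x y}, x ∈ carrier → y ∈ carrier → x * y ∈ carrier

namespace AISub

variable {S : Type*} [AISemiring S]

instance : SetLike (AISub S) S where
  coe := AISub.carrier
  coe_injective := fun _ _ h => AISub.ext h

instance (T : AISub S) : AISemiring T where
  add x y := ⟨x.1 + y.1, T.add_mem x.2 y.2⟩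
  mul x y := ⟨x.1 * y.1, T.mul_mem x.2 y.2⟩
  add_assoc x y z := Subtype.ext (add_assoc x.1 y.1 z.1)
  add_comm x y := Subtype.ext (add_comm x.1 y.1)
  mul_assoc x y z := Subtype.ext (mul_assoc x.1 y.1 z.1)
  left_distrib x y z := Subtype.ext (left_distrib x.1 y.1 z.1)
  right_distrib x y z := Subtype.ext (right_distrib x.1 y.1 z.1)
  add_idem x := Subtype.ext (AISemiring.add_idem x.1)

/-- The closed subset generated by `X`: the intersection of all closed subsets containing `X`. -/
def closure (X : Set S) : AISub S where
  carrier := {x | ∀ T : AISub S, X ⊆ T.carrier → x ∈ T.carrier}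
  add_mem hx hy := fun T hT => T.add_mem (hx T hT) (hy T hT)
  mul_mem hx hy := fun T hT => T.mul_mem (hx T hT) (hy T hT)

theorem subset_closure {X : Set S} {x : S} (hx : x ∈ X) : x ∈ closure X :=
  fun _ hT => hT hx

end AISub

/-- Direct products, with coordinatewise operations. -/
instance {ι : Type*} (A : ι → Type*) [∀ i, AISemiring (A i)] : AISemiring (∀ i, A i) where
  add_idem x := funext fun i => AISemiring.add_idem (x i)

/-- A copy of an ai-semiring in a larger universe. -/
instance {S : Type*} [AISemiring S] : AISemiring (ULift S) where
  left_distrib x y z := congrArg ULift.up (left_distrib x.down y.down z.down)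
  right_distrib x y z := congrArg ULift.up (right_distrib x.down y.down z.down)
  add_idem x := congrArg ULift.up (AISemiring.add_idem x.down)

universe u

/-- A bundled ai-semiring. As usual in universal algebra, the universe of an algebra is
nonempty. -/
structure AIAlg where
  carrier : Type u
  [str : AISemiring carrier]
  [nonempty : Nonempty carrier]

attribute [instance] AIAlg.str AIAlg.nonempty

/-- A variety of ai-semirings: a class of ai-semirings that is closed under (nonempty)
subalgebras, homomorphic images and arbitrary direct products. (The empty product is included,
so every variety contains the one-element algebras.) -/
@[ext]
structure AIVariety where
  mem : Set AIAlg.{u}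
  sub_mem : ∀ S ∈ mem, ∀ (T : AISub S.carrier) [Nonempty T], AIAlg.mk T ∈ mem
  hom_mem : ∀ S ∈ mem, ∀ (T : AIAlg.{u}) (f : AIHom S.carrier T.carrier),
    Function.Surjective f → T ∈ mem
  prod_mem : ∀ (ι : Type u) (A : ι → AIAlg.{u}), (∀ i, A i ∈ mem) →
    AIAlg.mk (∀ i, (A i).carrier) ∈ mem

namespace AIVariety

/-- Varieties are ordered by inclusion. -/
instance : PartialOrder AIVariety.{u} :=
  PartialOrder.lift AIVariety.mem fun _ _ h => AIVariety.ext h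

/-- The intersection of a family of varieties. -/
instance : InfSet AIVariety.{u} where
  sInf C :=
    { mem := {S | ∀ V ∈ C, S ∈ V.mem}
      sub_mem := fun S hS T _ V hV => V.sub_mem S (hS V hV) T
      hom_mem := fun S hS T f hf V hV => V.hom_mem S (hS V hV) T f hf
      prod_mem := fun ι A hA V hV => V.prod_mem ι A fun i => hA i V hV }

/-- The lattice of varieties: meets are intersections, and the join of a family is the smallest
variety containing every member of it. -/
instance : CompleteLattice AIVariety.{u} :=
  completeLatticeOfInf AIVariety.{u} fun _ =>
    ⟨fun V hV _ hS => hS V hV, fun _ hW _ hS _ hV => hW hV hS⟩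

/-- The trivial variety, consisting of the one-element ai-semirings. -/
def trivial : AIVariety.{u} where
  mem := {S | Subsingleton S.carrier}
  sub_mem := fun S hS T _ =>
    have : Subsingleton S.carrier := hS
    show Subsingleton T from inferInstance
  hom_mem := fun S hS _ _ hf =>
    have : Subsingleton S.carrier := hS
    hf.subsingleton
  prod_mem := fun _ A hA =>
    have : ∀ i, Subsingleton (A i).carrier := hA
    show Subsingleton (∀ i, (A i).carrier) from inferInstance

/-- The variety `V(A)` generated by `A`: the smallest variety containing (a copy of) `A`. -/
def generatedBy (A : Type) [AISemiring A] [Nonempty A] : AIVariety.{u} :=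
  sInf {V | AIAlg.mk (ULift.{u} A) ∈ V.mem}

end AIVariety

/-- The six-element set `{1, 2, 3, 4, 5, 6}`, with `si` standing for `i`. -/
inductive SR6 : Type
  | s1 | s2 | s3 | s4 | s5 | s6

namespace SR6

/-- The addition table; all pairs not listed have sum `1`. -/
def add : SR6 → SR6 → SR6
  | s2, s2 => s2
  | s2, s5 => s2
  | s5, s2 => s2
  | s3, s3 => s3
  | s4, s4 => s4
  | s4, s6 => s4
  | s6, s4 => s4
  | s5, s5 => s5
  | s6, s6 => s6
  | _, _ => s1

/-- The multiplication table; all pairs not listed have product `1`. -/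
def mul : SR6 → SR6 → SR6
  | s2, s6 => s3
  | s6, s2 => s3
  | s4, s5 => s3
  | s5, s4 => s3
  | s5, s6 => s3
  | s6, s5 => s3
  | _, _ => s1

instance : AISemiring SR6 where
  add := add
  mul := mul
  add_assoc x y z := by cases x <;> cases y <;> cases z <;> rfl
  add_comm x y := by cases x <;> cases y <;> rfl
  mul_assoc x y z := by cases x <;> cases y <;> cases z <;> rfl
  left_distrib x y z := by cases x <;> cases y <;> cases z <;> rfl
  right_distrib x y z := by cases x <;> cases y <;> cases z <;> rfl
  add_idem x := by cases x <;> rfl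

instance : Nonempty SR6 := ⟨s1⟩

end SR6

/-- `Sc W` consists of the nonempty subwords of words in `W` together with a new symbol `0`.
Commutative words over the alphabet `X` are nonzero multisets of letters, the product of words is
the sum of multisets, and subwords are submultisets. -/
inductive Sc {X : Type*} (W : Set (Multiset X))
  | zero : Sc W
  | word (u : Multiset X) (hne : u ≠ 0) (hsub : ∃ w ∈ W, u ≤ w) : Sc W

namespace Sc

variable {X : Type*} {W : Set (Multiset X)}

open Classical in
/-- The word `u` as an element of `Sc W` if it is a nonempty subword of a word in `W`,
and `0` otherwise. -/
noncomputable def ofWord (W : Set (Multiset X)) (u : Multiset X) : Sc W :=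
  if h : u ≠ 0 ∧ ∃ w ∈ W, u ≤ w then word u h.1 h.2 else zero

open Classical in
/-- `u + v = u` if `u = v`, and `u + v = 0` otherwise. -/
noncomputable def add (x y : Sc W) : Sc W := if x = y then x else zero

/-- `u * v = uv` if `u` and `v` are words and `uv` is again in `Sc W`, and `u * v = 0`
otherwise. -/
noncomputable def mul : Sc W → Sc W → Sc W
  | word u _ _, word v _ _ => ofWord W (u + v)
  | _, _ => zero

theorem zero_mul (y : Sc W) : mul zero y = zero := rfl

theorem mul_zero (x : Sc W) : mul x zero = zero := by cases x <;> rfl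

theorem ofWord_mul_ofWord {u v : Multiset X} (hu : u ≠ 0) (hv : v ≠ 0) :
    mul (ofWord W u) (ofWord W v) = ofWord W (u + v) := by
  by_cases h : ∃ w ∈ W, u + v ≤ w
  · obtain ⟨w, hw, hle⟩ := h
    have h1 : u ≠ 0 ∧ ∃ w ∈ W, u ≤ w := ⟨hu, w, hw, (Multiset.le_add_right u v).trans hle⟩
    have h2 : v ≠ 0 ∧ ∃ w ∈ W, v ≤ w := ⟨hv, w, hw, (Multiset.le_add_left v u).trans hle⟩
    rw [ofWord, dif_pos h1, ofWord, dif_pos h2]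
    rfl
  · have h0 : ofWord W (u + v) = zero := dif_neg fun h' => h h'.2
    rw [h0]
    by_cases h1 : u ≠ 0 ∧ ∃ w ∈ W, u ≤ w
    · by_cases h2 : v ≠ 0 ∧ ∃ w ∈ W, v ≤ w
      · rw [ofWord, dif_pos h1, ofWord, dif_pos h2]
        exact h0
      · rw [show ofWord W v = zero from dif_neg h2, mul_zero]
    · rw [show ofWord W u = zero from dif_neg h1, zero_mul]

theorem word_eq (u : Multiset X) (hne : u ≠ 0) (hsub : ∃ w ∈ W, u ≤ w) :
    word u hne hsub = ofWord W u := by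
  rw [ofWord, dif_pos (And.intro hne hsub)]

theorem mul_comm' (x y : Sc W) : mul x y = mul y x := by
  cases x <;> cases y <;> simp [mul, add_comm]

theorem mul_assoc' (x y z : Sc W) : mul (mul x y) z = mul x (mul y z) := by
  rcases x with _ | ⟨u, hu, hu'⟩
  · rfl
  rcases y with _ | ⟨v, hv, hv'⟩
  · rfl
  rcases z with _ | ⟨w, hw, hw'⟩
  · rw [mul_zero, mul_zero, mul_zero]
  have huv : u + v ≠ 0 := fun h => hu (by simpa using (add_eq_zero.mp h).1)
  have hvw : v + w ≠ 0 := fun h => hv (by simpa using (add_eq_zero.mp h).1)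
  rw [word_eq, word_eq, word_eq, ofWord_mul_ofWord hu hv, ofWord_mul_ofWord hv hw,
    ofWord_mul_ofWord huv hw, ofWord_mul_ofWord hu hvw, add_assoc]

theorem add_self' (x : Sc W) : add x x = x := if_pos rfl

theorem add_of_ne {x y : Sc W} (h : x ≠ y) : add x y = zero := if_neg h

theorem add_zero' (x : Sc W) : add x zero = zero := by
  by_cases h : x = zero
  · rw [h, add_self']
  · exact add_of_ne h

theorem add_comm' (x y : Sc W) : add x y = add y x := by
  by_cases h : x = y
  · rw [h]
  · rw [add_of_ne h, add_of_ne (Ne.symm h)]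

theorem add_assoc' (x y z : Sc W) : add (add x y) z = add x (add y z) := by
  by_cases h : x = y
  · subst h
    rw [add_self']
    by_cases h2 : x = z
    · subst h2
      rw [add_self', add_self']
    · rw [add_of_ne h2, add_zero']
  · rw [add_of_ne h, add_comm', add_zero']
    by_cases h2 : y = z
    · subst h2
      rw [add_self', add_of_ne h]
    · rw [add_of_ne h2, add_zero']

theorem mul_cancel {x y z : Sc W} (h : mul x y = mul x z) (h0 : mul x y ≠ zero) : y = z := by
  rcases x with _ | ⟨u, hu, hu'⟩
  · exact absurd rfl h0
  rcases y with _ | ⟨v, hv, hv'⟩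
  · exact absurd rfl h0
  rcases z with _ | ⟨w, hw, hw'⟩
  · exact absurd h h0
  change ofWord W (u + v) = ofWord W (u + w) at h
  change ofWord W (u + v) ≠ zero at h0
  have h1 : u + v ≠ 0 ∧ ∃ t ∈ W, u + v ≤ t := by
    by_contra h'
    exact h0 (dif_neg h')
  have h2 : u + w ≠ 0 ∧ ∃ t ∈ W, u + w ≤ t := by
    by_contra h'
    exact h0 (h.trans (dif_neg h'))
  rw [ofWord, dif_pos h1, ofWord, dif_pos h2] at h
  have h3 : v = w := by simpa using h
  subst h3
  rfl

theorem mul_add' (x y z : Sc W) : mul x (add y z) = add (mul x y) (mul x z) := by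
  by_cases h : y = z
  · subst h
    rw [add_self', add_self']
  · rw [add_of_ne h, mul_zero]
    by_cases h1 : mul x y = mul x z
    · by_cases h0 : mul x y = zero
      · rw [← h1, h0, add_self']
      · exact absurd (mul_cancel h1 h0) h
    · rw [add_of_ne h1]

noncomputable instance : AISemiring (Sc W) where
  add := add
  mul := mul
  add_assoc := add_assoc'
  add_comm := add_comm'
  mul_assoc := mul_assoc'
  left_distrib := mul_add'
  right_distrib x y z := by
    change mul (add x y) z = add (mul x z) (mul y z)
    rw [mul_comm', mul_add', mul_comm' z x, mul_comm' z y]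
  add_idem := add_self'

instance : Nonempty (Sc W) := ⟨zero⟩

end Sc

/-- The ai-semiring `S_c(a)`, with the letter `a` represented by `0`. -/
abbrev ScA : Type := Sc ({{0}} : Set (Multiset (Fin 2)))

/-- The ai-semiring `S_c(ab)`, with the letters `a` and `b` represented by `0` and `1`. -/
abbrev ScAB : Type := Sc ({{0, 1}} : Set (Multiset (Fin 2)))

/-! The algebras in V(SR6) satisfy `SR6Laws`. Fix an element m that is not the greatest, and join x
to y when xy ≤ m. By these laws the resulting graph is loopless and triangle-free, the elements
below m are isolated vertices, and no product of three elements lies below m. Hence whether the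
value of a term lies below m depends only on which letters and which edges lie below m.

This turns both membership in V(A) and maps onto A into graph problems. Suppose an assignment g into
A, or into a power of A, hits a suitable irreducible element θ exactly on the letters and edges
below m. Then by `AITerm.eval_eq_iff` a term takes the value θ under g if and only if its value in S
lies below m. If this is possible for every m that is not greatest, S inherits the identities of A
(`AIVariety.mem_of_separated`). If a single m works and θ separates the elements of A, a subalgebra
of S maps onto A (`AITerm.eval_congr_of_separated`).

The three nontrivial varieties correspond to shapes of these graphs. Under x² ≈ xy there are no
edges, and S_c(a) suffices. Under the inequality every path of length three closes up, so components
are complete bipartite and 2-colourings (`exists_coloring`) map S into powers of S_c(ab). A failure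
of the first identity is an edge, which yields S_c(ab). A failure of the second is an induced path
on four vertices, which is the graph of 2, 6, 5, 4 in SR6. The resulting dichotomies leave only the
four-element chain. -/

/-! ### Terms, generated subalgebras and homomorphisms defined on generators. -/

/-- Terms in the language of ai-semirings over the variables `X`. -/
inductive AITerm (X : Type*) : Type _
  | var (i : X) : AITerm X
  | add (s t : AITerm X) : AITerm X
  | mul (s t : AITerm X) : AITerm X

namespace AITerm

variable {X S T : Type*} [AISemiring S] [AISemiring T]

/-- The value of a term under an assignment of its variables. -/
def eval (v : X → S) : AITerm X → S
  | var i => v i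
  | add s t => s.eval v + t.eval v
  | mul s t => s.eval v * t.eval v

/-- To relate the values of all terms in two algebras, it suffices to treat words of length one,
words of length two and products of three elements, and to pass to sums. -/
theorem eval_induction (v : X → S) (g : X → T) {Q : S → T → Prop}
    (hvar : ∀ i, Q (v i) (g i)) (hmul : ∀ i j, Q (v i * v j) (g i * g j))
    (htriple : ∀ a b c a' b' c', Q (a * b * c) (a' * b' * c'))
    (hadd : ∀ a b a' b', Q a a' → Q b b' → Q (a + b) (a' + b')) (t : AITerm X) :
    Q (t.eval v) (t.eval g) := by
  have h1 : ∀ (t : AITerm X) i, Q (t.eval v * v i) (t.eval g * g i) := by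
    intro t i
    induction t with
    | var j => exact hmul j i
    | add s t hs ht =>
      simp only [eval, right_distrib]
      exact hadd _ _ _ _ hs ht
    | mul s t _ _ => exact htriple _ _ _ _ _ _
  have h2 : ∀ s t : AITerm X, Q (s.eval v * t.eval v) (s.eval g * t.eval g) := by
    intro s t
    induction t with
    | var j => exact h1 s j
    | add t u ht hu =>
      simp only [eval, left_distrib]
      exact hadd _ _ _ _ ht hu
    | mul t u _ _ =>
      simp only [eval, ← mul_assoc]
      exact htriple _ _ _ _ _ _
  induction t with
  | var i => exact hvar i
  | add s t hs ht => exact hadd _ _ _ _ hs ht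
  | mul s t _ _ => exact h2 s t

theorem eval_pi {ι : Type*} {A : ι → Type*} [∀ i, AISemiring (A i)] (v : X → ∀ i, A i)
    (t : AITerm X) (i : ι) : t.eval v i = t.eval fun x => v x i := by
  induction t with
  | var j => rfl
  | add s t hs ht => exact congrArg₂ (· + ·) hs ht
  | mul s t hs ht => exact congrArg₂ (· * ·) hs ht

end AITerm

theorem AIHom.map_eval {X S T : Type*} [AISemiring S] [AISemiring T] (f : AIHom S T) (v : X → S)
    (t : AITerm X) : f (t.eval v) = t.eval fun x => f (v x) := by
  induction t with
  | var j => rfl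
  | add s t hs ht => exact (f.map_add _ _).trans (congrArg₂ (· + ·) hs ht)
  | mul s t hs ht => exact (f.map_mul _ _).trans (congrArg₂ (· * ·) hs ht)

namespace AISemiring

variable {S : Type*} [AISemiring S]

/-- `x + y` lies below `m` exactly if both summands do. -/
theorem add_add_eq_iff (x y m : S) : x + y + m = m ↔ x + m = m ∧ y + m = m := by
  constructor
  · intro h
    constructor
    · rw [← h, ← add_assoc, ← add_assoc, add_idem]
    · rw [← h, add_comm x y, ← add_assoc, ← add_assoc, add_idem]
  · rintro ⟨h1, h2⟩
    rw [add_assoc, h2, h1]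

theorem eq_of_forall_le_iff {x y : S} (h : ∀ m, x + m = m ↔ y + m = m) : x = y := by
  have h1 := (h x).1 (add_idem x)
  have h2 := (h y).2 (add_idem y)
  rw [← h1, add_comm, h2]

end AISemiring

namespace AISub

variable {X S T : Type*} [AISemiring S] [AISemiring T]

theorem eval_mem (T : AISub S) (v : X → S) (hv : ∀ i, v i ∈ T) (t : AITerm X) :
    t.eval v ∈ T := by
  induction t with
  | var i => exact hv i
  | add s t hs ht => exact T.add_mem hs ht
  | mul s t hs ht => exact T.mul_mem hs ht

theorem exists_eval_of_mem_closure {v : X → S} {Y : Set S} (hY : Y ⊆ Set.range v) {x : S}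
    (hx : x ∈ closure Y) : ∃ t : AITerm X, t.eval v = x := by
  let R : AISub S :=
    { carrier := Set.range fun t : AITerm X => t.eval v
      add_mem := by
        rintro _ _ ⟨s, rfl⟩ ⟨t, rfl⟩
        exact ⟨s.add t, rfl⟩
      mul_mem := by
        rintro _ _ ⟨s, rfl⟩ ⟨t, rfl⟩
        exact ⟨s.mul t, rfl⟩ }
  refine hx R fun y hy => ?_
  obtain ⟨i, rfl⟩ := hY hy
  exact ⟨AITerm.var i, rfl⟩

/-- An assignment of the generators extends to a homomorphism if it respects all equations
between terms. -/
theorem exists_hom_closure {v : X → S} {Y : Set S} (hY : Set.range v = Y) (g : X → T)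
    (h : ∀ s t : AITerm X, s.eval v = t.eval v → s.eval g = t.eval g) :
    ∃ f : AIHom (closure Y) T,
      (∀ (t : AITerm X) (ht : t.eval v ∈ closure Y), f ⟨t.eval v, ht⟩ = t.eval g) ∧
      ((∀ y, ∃ t : AITerm X, t.eval g = y) → Function.Surjective f) := by
  choose r hr using fun x : closure Y => exists_eval_of_mem_closure hY.symm.subset x.2
  have key : ∀ (x : closure Y) (t : AITerm X), t.eval v = x.1 → (r x).eval g = t.eval g :=
    fun x t ht => h _ _ ((hr x).trans ht.symm)
  refine ⟨⟨fun x => (r x).eval g, fun x y => ?_, fun x y => ?_⟩,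
    fun t ht => key _ _ rfl, fun hg y => ?_⟩
  · exact key _ ((r x).add (r y)) (congrArg₂ (· + ·) (hr x) (hr y))
  · exact key _ ((r x).mul (r y)) (congrArg₂ (· * ·) (hr x) (hr y))
  · obtain ⟨t, rfl⟩ := hg y
    exact ⟨⟨t.eval v, eval_mem _ v (fun i => subset_closure (hY.subset ⟨i, rfl⟩)) t⟩, key _ _ rfl⟩

end AISub

namespace AITerm

variable {X S T : Type*} [AISemiring S] [AISemiring T]

/-- If `θ` is additively irreducible in the sense that only sums of copies of `θ` give `θ`, then
the fibre of `θ` under a partial homomorphism on the generators is an order ideal. -/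
theorem eval_eq_iff {v : X → S} {g : X → T} {m : S} {θ : T}
    (hS : ∀ x y z : S, x * y * z + m ≠ m) (hT : ∀ x y z : T, x * y * z ≠ θ)
    (hadd : ∀ x y : T, x + y = θ ↔ x = θ ∧ y = θ) (hvar : ∀ i, g i = θ ↔ v i + m = m)
    (hmul : ∀ i j, g i * g j = θ ↔ v i * v j + m = m) (t : AITerm X) :
    t.eval g = θ ↔ t.eval v + m = m := by
  refine eval_induction v g (Q := fun x y => y = θ ↔ x + m = m) hvar hmul ?_ ?_ t
  · intro a b c a' b' c'
    exact iff_of_false (hT _ _ _) (hS _ _ _)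
  · intro a b a' b' h1 h2
    rw [hadd, AISemiring.add_add_eq_iff, h1, h2]

/-- A term times a variable is again a term, so the tests `x = θ` and `x * g i = θ` on a value in
`T` can be read off from the value in `S`. By `hsep` these tests determine an element of `T`. -/
theorem eval_congr_of_separated {v : X → S} {g : X → T} {m : S} {θ : T}
    (hS : ∀ x y z : S, x * y * z + m ≠ m) (hT : ∀ x y z : T, x * y * z ≠ θ)
    (hadd : ∀ x y : T, x + y = θ ↔ x = θ ∧ y = θ) (hvar : ∀ i, g i = θ ↔ v i + m = m)
    (hmul : ∀ i j, g i * g j = θ ↔ v i * v j + m = m)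
    (hsep : ∀ x y : T, (x = θ ↔ y = θ) → (∀ i, x * g i = θ ↔ y * g i = θ) → x = y)
    (s t : AITerm X) (h : s.eval v = t.eval v) : s.eval g = t.eval g := by
  have key := eval_eq_iff hS hT hadd hvar hmul
  refine hsep _ _ (by rw [key, key, h]) fun i => ?_
  have h1 := key (s.mul (var i))
  have h2 := key (t.mul (var i))
  simp only [eval] at h1 h2
  rw [h1, h2, h]

end AITerm

/-! ### Identities and generated varieties. -/

namespace AIVariety

/-- The variety defined by one identity. -/
def ofIdentity {X : Type} (s t : AITerm X) : AIVariety.{u} where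
  mem := {S | ∀ v : X → S.carrier, s.eval v = t.eval v}
  sub_mem := by
    intro S hS T _ v
    let f : AIHom T S.carrier := ⟨Subtype.val, fun _ _ => rfl, fun _ _ => rfl⟩
    have h := hS fun x => f (v x)
    rw [← f.map_eval, ← f.map_eval] at h
    exact Subtype.ext h
  hom_mem := by
    intro S hS T f hf v
    choose r hr using hf
    have h := congrArg f (hS fun x => r (v x))
    rw [f.map_eval, f.map_eval] at h
    simpa only [hr] using h
  prod_mem := by
    intro ι A hA v
    funext i
    rw [AITerm.eval_pi, AITerm.eval_pi]
    exact hA i _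

theorem mem_generatedBy (A : Type) [AISemiring A] [Nonempty A] :
    AIAlg.mk (ULift.{u} A) ∈ (generatedBy.{u} A).mem :=
  fun _ hV => hV

theorem generatedBy_le_iff {A : Type} [AISemiring A] [Nonempty A] {V : AIVariety.{u}} :
    generatedBy A ≤ V ↔ AIAlg.mk (ULift.{u} A) ∈ V.mem :=
  ⟨fun h => h (mem_generatedBy A), fun h => sInf_le h⟩

theorem identity_of_mem {A : Type} [AISemiring A] [Nonempty A] {X : Type} {s t : AITerm X}
    (h : ∀ v : X → A, s.eval v = t.eval v) {S : AIAlg.{u}} (hS : S ∈ (generatedBy.{u} A).mem)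
    (v : X → S.carrier) : s.eval v = t.eval v := by
  have h1 : generatedBy.{u} A ≤ ofIdentity s t := by
    rw [generatedBy_le_iff]
    intro w
    let f : AIHom (ULift.{u} A) A := ⟨ULift.down, fun _ _ => rfl, fun _ _ => rfl⟩
    have h2 := h fun x => f (w x)
    rw [← f.map_eval, ← f.map_eval] at h2
    exact ULift.ext _ _ h2
  exact h1 hS v

/-- An algebra that satisfies all identities of `A` lies in the variety generated by `A`. -/
theorem mem_of_identities {A : Type} [AISemiring A] [Nonempty A] (S : AIAlg.{u})
    (h : ∀ s t : AITerm S.carrier, (∀ v : S.carrier → A, s.eval v = t.eval v) →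
      s.eval id = t.eval id) : S ∈ (generatedBy.{u} A).mem := by
  -- The coordinate projections generate the free algebra of V(A) on the set `S.carrier`; `S` is its
  -- image under the map sending each projection to the corresponding element.
  let proj : S.carrier → (S.carrier → A) → ULift.{u} A := fun x v => ULift.up (v x)
  obtain ⟨f, -, hf⟩ := AISub.exists_hom_closure (v := proj) rfl (id : S.carrier → S.carrier) (by
    intro s t hst
    refine h s t fun v => ?_
    let d : AIHom (ULift.{u} A) A := ⟨ULift.down, fun _ _ => rfl, fun _ _ => rfl⟩
    have h1 := congrArg d (congrFun hst v)
    rwa [AITerm.eval_pi, AITerm.eval_pi, d.map_eval, d.map_eval] at h1)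
  have hmem : ∀ x, proj x ∈ AISub.closure (Set.range proj) :=
    fun x => AISub.subset_closure ⟨x, rfl⟩
  have hne : Nonempty (AISub.closure (Set.range proj)) :=
    ⟨⟨_, hmem (Classical.choice S.nonempty)⟩⟩
  have h1 := (generatedBy.{u} A).prod_mem (S.carrier → A) (fun _ => AIAlg.mk (ULift.{u} A))
    fun _ => mem_generatedBy A
  have h2 := (generatedBy.{u} A).sub_mem _ h1 (AISub.closure (Set.range proj))
  exact (generatedBy.{u} A).hom_mem _ h2 S f (hf fun x => ⟨AITerm.var x, rfl⟩)

/-- An element is determined by its upper bounds. For a bound `m` that is not greatest, the terms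
below `m` are those with value `θ` in a power of `A`, so terms that agree in `A` have the same upper
bounds in `S`. -/
theorem mem_of_separated {A : Type} [AISemiring A] [Nonempty A] (S : AIAlg.{u})
    (h : ∀ m : S.carrier, (∀ x, x + m = m) ∨
      ∃ (C : Type u) (θ : C → A) (g : S.carrier → C → A),
        (∀ x y z : S.carrier, x * y * z + m ≠ m) ∧ (∀ x y z : C → A, x * y * z ≠ θ) ∧
        (∀ x y : C → A, x + y = θ ↔ x = θ ∧ y = θ) ∧ (∀ x, g x = θ ↔ x + m = m) ∧
        (∀ x y, g x * g y = θ ↔ x * y + m = m)) : S ∈ (generatedBy.{u} A).mem := by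
  refine mem_of_identities S fun s t hst => AISemiring.eq_of_forall_le_iff fun m => ?_
  obtain hm | ⟨C, θ, g, hS, hT, hadd, hvar, hmul⟩ := h m
  · exact iff_of_true (hm _) (hm _)
  · have key := AITerm.eval_eq_iff (v := id) hS hT hadd hvar hmul
    rw [← key, ← key, show s.eval g = t.eval g from funext fun c => by
      rw [AITerm.eval_pi, AITerm.eval_pi, hst]]

/-- A variety contains the variety generated by `A` as soon as it contains an algebra with a
subalgebra that maps onto `A`. -/
theorem generatedBy_le_of_hom {A : Type} [AISemiring A] [Nonempty A] {V : AIVariety.{u}}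
    {S : AIAlg.{u}} (hS : S ∈ V.mem) (T : AISub S.carrier) (f : AIHom T A)
    (hf : Function.Surjective f) : generatedBy A ≤ V := by
  rw [generatedBy_le_iff]
  have hne : Nonempty T := ⟨(hf (Classical.choice inferInstance)).choose⟩
  let f' : AIHom T (ULift.{u} A) := ⟨fun x => ULift.up (f x),
    fun x y => congrArg ULift.up (f.map_add x y), fun x y => congrArg ULift.up (f.map_mul x y)⟩
  refine V.hom_mem _ (V.sub_mem S hS T) (AIAlg.mk (ULift.{u} A)) f' ?_
  rintro ⟨y⟩
  obtain ⟨x, hx⟩ := hf y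
  exact ⟨x, congrArg ULift.up hx⟩

theorem trivial_le (V : AIVariety.{u}) : trivial ≤ V := by
  intro S hS
  have hS : Subsingleton S.carrier := hS
  -- The empty product is a one-element algebra, and it maps onto every other one.
  have h := V.prod_mem PEmpty (fun _ => S) fun i => i.elim
  exact V.hom_mem _ h S ⟨fun _ => Classical.choice S.nonempty, fun _ _ => Subsingleton.elim _ _,
    fun _ _ => Subsingleton.elim _ _⟩ fun y => ⟨fun i => i.elim, Subsingleton.elim _ _⟩

end AIVariety

/-! ### Arithmetic of S_c(a) and S_c(ab). -/

namespace Sc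

variable {X : Type*} {W : Set (Multiset X)}

theorem add_eq_iff {x y z : Sc W} (hz : z ≠ zero) : x + y = z ↔ x = z ∧ y = z := by
  constructor
  · intro h
    by_cases hxy : x = y
    · subst hxy
      rw [show x + x = x from add_self' x] at h
      exact ⟨h, h⟩
    · exact absurd (h.symm.trans (add_of_ne hxy)) hz
  · rintro ⟨rfl, rfl⟩
    exact add_self' _

theorem ofWord_eq_zero {u : Multiset X} (h : ∀ w ∈ W, ¬ u ≤ w) : ofWord W u = zero :=
  dif_neg fun ⟨_, w, hw, hle⟩ => h w hw hle

theorem ofWord_ne_zero {u : Multiset X} (hu : u ≠ 0) {w : Multiset X} (hw : w ∈ W) (h : u ≤ w) :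
    ofWord W u ≠ zero := by
  rw [ofWord, dif_pos ⟨hu, w, hw, h⟩]
  exact fun h => by cases h

theorem ofWord_ne {u v : Multiset X} (hu : u ≠ 0) {w : Multiset X} (hw : w ∈ W) (h : u ≤ w)
    (huv : u ≠ v) : ofWord W u ≠ ofWord W v := by
  by_cases hv : v ≠ 0 ∧ ∃ w ∈ W, v ≤ w
  · rw [ofWord, dif_pos ⟨hu, w, hw, h⟩, ofWord, dif_pos hv]
    intro h'
    exact huv (by simpa using h')
  · rw [show ofWord W v = zero from dif_neg hv]
    exact ofWord_ne_zero hu hw h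

end Sc

namespace ScA

/-- The letter `a`. -/
noncomputable def a : ScA := Sc.ofWord {{0}} {0}

theorem a_ne_zero : a ≠ Sc.zero := Sc.ofWord_ne_zero (by decide) rfl le_rfl

theorem eq_zero_or (x : ScA) : x = Sc.zero ∨ x = a := by
  rcases x with _ | ⟨u, hu, hu'⟩
  · exact Or.inl rfl
  · right
    obtain ⟨w, rfl, hle⟩ := hu'
    rw [Sc.word_eq]
    rcases Multiset.le_singleton.1 hle with h | h
    · exact absurd h hu
    · rw [h, a]

theorem mul_eq_zero (x y : ScA) : x * y = Sc.zero := by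
  rcases eq_zero_or x with rfl | rfl
  · rfl
  rcases eq_zero_or y with rfl | rfl
  · exact Sc.mul_zero _
  refine (Sc.ofWord_mul_ofWord (by decide) (by decide)).trans (Sc.ofWord_eq_zero ?_)
  rintro _ rfl
  decide

end ScA

namespace ScAB

/-- The letter `a`. -/
noncomputable def a : ScAB := Sc.ofWord {{0, 1}} {0}

/-- The letter `b`. -/
noncomputable def b : ScAB := Sc.ofWord {{0, 1}} {1}

/-- The word `ab`. -/
noncomputable def ab : ScAB := Sc.ofWord {{0, 1}} {0, 1}

theorem a_ne_zero : a ≠ Sc.zero := Sc.ofWord_ne_zero (by decide) rfl (by decide)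

theorem b_ne_zero : b ≠ Sc.zero := Sc.ofWord_ne_zero (by decide) rfl (by decide)

theorem ab_ne_zero : ab ≠ Sc.zero := Sc.ofWord_ne_zero (by decide) rfl (by decide)

theorem a_ne_b : a ≠ b := Sc.ofWord_ne (by decide) rfl (by decide) (by decide)

theorem a_ne_ab : a ≠ ab := Sc.ofWord_ne (by decide) rfl (by decide) (by decide)

theorem b_ne_ab : b ≠ ab := Sc.ofWord_ne (by decide) rfl (by decide) (by decide)

theorem cases (x : ScAB) : x = Sc.zero ∨ x = a ∨ x = b ∨ x = ab := by
  rcases x with _ | ⟨u, hu, hu'⟩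
  · exact Or.inl rfl
  · right
    obtain ⟨w, rfl, hle⟩ := hu'
    rw [Sc.word_eq]
    have h := Multiset.mem_powerset.2 hle
    rw [show Multiset.powerset ({0, 1} : Multiset (Fin 2)) = {0, {0}, {1}, {0, 1}} by decide] at h
    simp only [Multiset.insert_eq_cons, Multiset.mem_cons, Multiset.mem_singleton] at h
    rcases h with h | h | h | h
    · exact absurd h hu
    all_goals subst h
    · exact Or.inl rfl
    · exact Or.inr (Or.inl rfl)
    · exact Or.inr (Or.inr rfl)

theorem a_mul_b : a * b = ab := Sc.ofWord_mul_ofWord (by decide) (by decide)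

theorem b_mul_a : b * a = ab := (Sc.mul_comm' _ _).trans a_mul_b

theorem ofWord_mul_eq_zero {u v : Multiset (Fin 2)} (hu : u ≠ 0) (hv : v ≠ 0)
    (h : ¬ u + v ≤ {0, 1}) : (Sc.ofWord {{0, 1}} u : ScAB) * Sc.ofWord {{0, 1}} v = Sc.zero :=
  (Sc.ofWord_mul_ofWord hu hv).trans (Sc.ofWord_eq_zero (by rintro _ rfl; exact h))

theorem a_mul_a : a * a = Sc.zero :=
  ofWord_mul_eq_zero (by decide) (by decide) (by decide)

theorem b_mul_b : b * b = Sc.zero :=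
  ofWord_mul_eq_zero (by decide) (by decide) (by decide)

theorem ab_mul (x : ScAB) : ab * x = Sc.zero := by
  rcases cases x with rfl | rfl | rfl | rfl
  · exact Sc.mul_zero _
  · exact ofWord_mul_eq_zero (by decide) (by decide) (by decide)
  · exact ofWord_mul_eq_zero (by decide) (by decide) (by decide)
  · exact ofWord_mul_eq_zero (by decide) (by decide) (by decide)

theorem mul_ab (x : ScAB) : x * ab = Sc.zero := (Sc.mul_comm' _ _).trans (ab_mul x)

theorem zero_mul (x : ScAB) : (Sc.zero : ScAB) * x = Sc.zero := rfl

theorem mul_zero (x : ScAB) : x * (Sc.zero : ScAB) = Sc.zero := Sc.mul_zero x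

theorem mul_eq_ab_iff (x y : ScAB) : x * y = ab ↔ x = a ∧ y = b ∨ x = b ∧ y = a := by
  rcases cases x with rfl | rfl | rfl | rfl <;> rcases cases y with rfl | rfl | rfl | rfl <;>
    simp [zero_mul, mul_zero, a_mul_a, a_mul_b, b_mul_a, b_mul_b, ab_mul, mul_ab, a_ne_zero.symm,
      b_ne_zero.symm, ab_ne_zero.symm, a_ne_b, a_ne_b.symm, a_ne_ab.symm, b_ne_ab.symm]

theorem mul_eq_zero_or (x y : ScAB) : x * y = Sc.zero ∨ x * y = ab := by
  rcases cases x with rfl | rfl | rfl | rfl <;> rcases cases y with rfl | rfl | rfl | rfl <;>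
    simp [zero_mul, mul_zero, a_mul_a, a_mul_b, b_mul_a, b_mul_b, ab_mul, mul_ab]

theorem mul_mul_ne (x y z : ScAB) : x * y * z ≠ ab := by
  rcases mul_eq_zero_or x y with h | h <;> rw [h]
  · exact ab_ne_zero.symm
  · rw [ab_mul]
    exact ab_ne_zero.symm

/-- If the right-hand side is not the greatest element `zero`, flatness of the order forces xy = yz
= zw; cancelling z gives w = y, hence xw = xy. -/
theorem path_inequality (x y z w : ScAB) :
    x * w + (x * y + y * z + z * w) = x * y + y * z + z * w := by
  by_cases h : x * y + y * z + z * w = Sc.zero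
  · rw [h]
    exact Sc.add_zero' _
  · obtain ⟨h1, h2⟩ := (Sc.add_eq_iff h).1 rfl
    obtain ⟨h3, h4⟩ := (Sc.add_eq_iff h).1 h1
    have h5 : w = y := by
      refine Sc.mul_cancel (x := z) (h2.trans (h4.symm.trans (Sc.mul_comm' _ _))) fun h6 => h ?_
      rw [← h2]
      exact h6
    rw [show x * w = x * y + y * z + z * w from h5.symm ▸ h3]
    exact Sc.add_self' _

end ScAB

/-! ### Laws of V(SR6) and the graph of products below an element. -/

namespace AISemiring

/-- Laws of `V(SR6)`: the multiplication is commutative, squares and products of three elements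
coincide and form the greatest element, a sum of an element and one of its multiples is the
greatest element, and so is the sum of the edges of a triangle. -/
structure SR6Laws (S : Type*) [AISemiring S] : Prop where
  comm : ∀ x y : S, x * y = y * x
  add_sq : ∀ x y : S, x + y * y = y * y
  triple : ∀ x y z : S, x * y * z = x * x
  add_mul : ∀ x y : S, x + x * y = x * x
  triangle : ∀ x y z : S, x * y + y * z + x * z = x * x

end AISemiring

theorem SR6.laws_of_mem {S : AIAlg.{u}} (hS : S ∈ (AIVariety.generatedBy.{u} SR6).mem) :
    AISemiring.SR6Laws S.carrier := by
  have key := fun (s t : AITerm (Fin 3)) (h : ∀ x y z : SR6, s.eval ![x, y, z] = t.eval ![x, y, z])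
    (x y z : S.carrier) => AIVariety.identity_of_mem (s := s) (t := t) (fun v => by
      have h1 := h (v 0) (v 1) (v 2)
      rwa [show ![v 0, v 1, v 2] = v from by funext i; fin_cases i <;> rfl] at h1) hS ![x, y, z]
  let x : AITerm (Fin 3) := .var 0
  let y : AITerm (Fin 3) := .var 1
  let z : AITerm (Fin 3) := .var 2
  constructor
  · intro p q
    exact key (x.mul y) (y.mul x) (by intro a b c; cases a <;> cases b <;> rfl) p q q
  · intro p q
    exact key (x.add (y.mul y)) (y.mul y) (by intro a b c; cases a <;> cases b <;> rfl) p q q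
  · exact key ((x.mul y).mul z) (x.mul x)
      (by intro a b c; cases a <;> cases b <;> cases c <;> rfl)
  · intro p q
    exact key (x.add (x.mul y)) (x.mul x) (by intro a b c; cases a <;> cases b <;> rfl) p q q
  · exact key (((x.mul y).add (y.mul z)).add (x.mul z)) (x.mul x)
      (by intro a b c; cases a <;> cases b <;> cases c <;> rfl)

namespace AISemiring.SR6Laws

variable {S : Type*} [AISemiring S]

theorem sq_eq_sq (h : SR6Laws S) (x y : S) : x * x = y * y := by
  rw [← h.add_sq (x * x) y, add_comm, h.add_sq]

theorem eq_sq_of_sq_le (h : SR6Laws S) {m x : S} (hx : x * x + m = m) (y : S) : m = y * y := by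
  rw [← hx, add_comm, h.add_sq, h.sq_eq_sq]

/-- All squares equal the greatest element. Here and below, `hu` says that `m` is not greatest;
under it the relation xy ≤ m is loopless, by this lemma, and triangle-free, by `mul_not_le_of_path`.
-/
theorem sq_not_le (h : SR6Laws S) {m u : S} (hu : u + m ≠ m) (x : S) : x * x + m ≠ m := by
  intro hx
  apply hu
  rw [h.eq_sq_of_sq_le hx x, h.add_sq]

theorem triple_not_le (h : SR6Laws S) {m u : S} (hu : u + m ≠ m) (x y z : S) :
    x * y * z + m ≠ m := by
  rw [h.triple]
  exact h.sq_not_le hu x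

theorem not_le_of_mul_le (h : SR6Laws S) {m u : S} (hu : u + m ≠ m) {x y : S}
    (hxy : x * y + m = m) : x + m ≠ m := by
  intro hx
  apply h.sq_not_le hu x
  rw [← h.add_mul x y, add_add_eq_iff]
  exact ⟨hx, hxy⟩

theorem mul_le_comm (h : SR6Laws S) {m x y : S} (hxy : x * y + m = m) : y * x + m = m := by
  rwa [h.comm]

theorem mul_not_le_of_path (h : SR6Laws S) {m u : S} (hu : u + m ≠ m) {x y z : S}
    (hxy : x * y + m = m) (hyz : y * z + m = m) : x * z + m ≠ m := by
  intro hxz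
  apply h.sq_not_le hu x
  rw [← h.triangle x y z, add_add_eq_iff, add_add_eq_iff]
  exact ⟨⟨hxy, hyz⟩, hxz⟩

end AISemiring.SR6Laws

/-! ### Two-colourings of graphs whose paths of length three close up. -/

/-- A triangle-free relation in which the ends of every path of length three are related has a
proper 2-colouring that is constant on a given unrelated pair. -/
theorem exists_coloring {V : Type*} (r : V → V → Prop) (symm : ∀ {x y}, r x y → r y x)
    (path : ∀ {x y z w}, r x y → r y z → r z w → r x w)
    (triangle : ∀ {x y z}, r x y → r y z → ¬ r x z) {z w : V} (hzw : ¬ r z w) :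
    ∃ c : V → Bool, (∀ x y, r x y → c x ≠ c y) ∧ c z = c w := by
  classical
  -- Since `path` shortens walks by two edges, every walk of even length reduces to length 0 or 2
  -- and every odd one to a single edge. So `same` means joined by an even walk, and `same` or `r`
  -- is connectedness.
  let same : V → V → Prop := fun u v => u = v ∨ ∃ x, r u x ∧ r x v
  have same_symm : ∀ {u v}, same u v → same v u := by
    rintro u v (rfl | ⟨x, h1, h2⟩)
    · exact Or.inl rfl
    · exact Or.inr ⟨x, symm h2, symm h1⟩
  have same_r : ∀ {u v x}, same u v → r v x → r u x := by
    rintro u v x (rfl | ⟨y, h1, h2⟩) h3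
    · exact h3
    · exact path h1 h2 h3
  have same_trans : ∀ {u v x}, same u v → same v x → same u x := by
    rintro u v x h (rfl | ⟨y, h1, h2⟩)
    · exact h
    · exact Or.inr ⟨y, same_r h h1, h2⟩
  have not_both : ∀ {u v}, same u v → ¬ r u v := by
    rintro u v (rfl | ⟨x, h1, h2⟩) h3
    · exact triangle h3 h3 h3
    · exact triangle h1 h2 h3
  let conn : Setoid V :=
    { r := fun u v => same u v ∨ r u v
      iseqv :=
        { refl := fun u => Or.inl (Or.inl rfl)
          symm := Or.imp same_symm symm
          trans := by
            rintro u v x (h1 | h1) (h2 | h2)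
            · exact Or.inl (same_trans h1 h2)
            · exact Or.inr (same_r h1 h2)
            · exact Or.inr (symm (same_r (same_symm h2) (symm h1)))
            · exact Or.inl (Or.inr ⟨v, h1, h2⟩) } }
  let rep : V → V := fun u => (Quotient.mk conn u).out
  have rep_conn : ∀ u, same u (rep u) ∨ r u (rep u) := fun u => conn.symm (Quotient.mk_out u)
  have rep_eq : ∀ {u v}, r u v → rep u = rep v := fun {u v} h =>
    congrArg Quotient.out (Quotient.sound (s := conn) (Or.inr h))
  -- The colour is the parity of the walks to the representative of the component. Adjacent vertices
  -- of equal colour would give an even walk between them or a triangle with the representative.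
  let c : V → Bool := fun u => decide (same u (rep u))
  have hc : ∀ x y, r x y → c x ≠ c y := by
    intro x y h h'
    have h'' : same x (rep x) ↔ same y (rep y) := by simpa [c] using h'
    rw [← rep_eq h] at h''
    by_cases hx : same x (rep x)
    · exact not_both (same_trans hx (same_symm (h''.1 hx))) h
    · have hx' := (rep_conn x).resolve_left hx
      have hy' := (rep_conn y).resolve_left (by rwa [← rep_eq h, ← h''])
      rw [← rep_eq h] at hy'
      exact triangle h hy' hx'
  by_cases hconn : same z w
  · refine ⟨c, hc, ?_⟩
    rcases hconn with rfl | ⟨x, h1, h2⟩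
    · rfl
    · have h3 := hc _ _ h1
      have h4 := hc _ _ h2
      revert h3 h4
      cases c z <;> cases c x <;> cases c w <;> simp
  -- Now `z` and `w` lie in different components, so the colours on the component of `z` may be
  -- swapped if `c z` and `c w` differ.
  · let d : Bool := xor (c z) (c w)
    refine ⟨fun u => if conn.r u z then xor d (c u) else c u, fun x y h => ?_, ?_⟩
    · have h1 : conn.r x z ↔ conn.r y z :=
        ⟨fun h2 => conn.trans (Or.inr (symm h)) h2, fun h2 => conn.trans (Or.inr h) h2⟩
      have h2 := hc x y h
      by_cases h3 : conn.r y z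
      · simpa [h1, h3] using h2
      · simpa [h1, h3] using h2
    · have h1 : conn.r z z := conn.refl z
      have h2 : ¬ conn.r w z := fun h => (conn.symm h).elim hconn hzw
      simp only [h1, h2, if_true, if_false, d]
      cases c z <;> cases c w <;> rfl

/-! ### Algebras satisfying the identities lie in V(S_c(a)) or V(S_c(ab)). -/

namespace Sc

theorem pi_add_eq_iff {C X : Type*} {W : Set (Multiset X)} {e : Sc W} (he : e ≠ zero)
    (x y : C → Sc W) : x + y = (fun _ => e) ↔ x = (fun _ => e) ∧ y = fun _ => e := by
  simp only [funext_iff, ← forall_and]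
  exact forall_congr' fun c => add_eq_iff he

end Sc

open Classical in
-- Every product is a square, hence greatest, and never lies below `m`. So the indicator of the
-- elements below `m`, with one coordinate, is enough.
theorem ScA.mem_of_laws {S : AIAlg.{u}} (h : AISemiring.SR6Laws S.carrier)
    (hS : ∀ x y : S.carrier, x * x = x * y) : S ∈ (AIVariety.generatedBy.{u} ScA).mem := by
  refine AIVariety.mem_of_separated S fun m => or_iff_not_imp_left.2 fun hm => ?_
  obtain ⟨u, hu⟩ := not_forall.1 hm
  have hprod : ∀ x y : PUnit.{u+1} → ScA, x * y ≠ fun _ => a := fun x y hxy =>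
    a_ne_zero ((congrFun hxy ⟨⟩).symm.trans (mul_eq_zero _ _))
  refine ⟨PUnit, fun _ => a, fun x _ => if x + m = m then a else Sc.zero, h.triple_not_le hu,
    fun x y z => hprod _ _, Sc.pi_add_eq_iff a_ne_zero, fun x => ?_, fun x y => ?_⟩
  · by_cases hx : x + m = m <;> simp [hx, funext_iff, a_ne_zero.symm]
  · refine iff_of_false (hprod _ _) ?_
    rw [← hS]
    exact h.sq_not_le hu x

open Classical in
theorem ScAB.mem_of_laws {S : AIAlg.{u}} (h : AISemiring.SR6Laws S.carrier)
    (hS : ∀ x y z w : S.carrier,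
      x * w + (x * y + y * z + z * w) = x * y + y * z + z * w) :
    S ∈ (AIVariety.generatedBy.{u} ScAB).mem := by
  refine AIVariety.mem_of_separated S fun m => or_iff_not_imp_left.2 fun hm => ?_
  obtain ⟨u, hu⟩ := not_forall.1 hm
  have hcol : ∀ z w : S.carrier, z * w + m ≠ m → ∃ c : S.carrier → Bool,
      (∀ x y, x * y + m = m → c x ≠ c y) ∧ c z = c w := by
    intro z w hzw
    refine exists_coloring (fun x y => x * y + m = m) h.mul_le_comm ?_
      (fun h1 h2 => h.mul_not_le_of_path hu h1 h2) hzw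
    -- The defining inequality closes up paths of length three in the graph of products below `m`.
    intro x y z w h1 h2 h3
    have h4 : x * y + y * z + z * w + m = m := by
      rw [AISemiring.add_add_eq_iff, AISemiring.add_add_eq_iff]
      exact ⟨⟨h1, h2⟩, h3⟩
    rw [← hS, AISemiring.add_add_eq_iff] at h4
    exact h4.1
  -- There is one coordinate for each proper 2-colouring. Edges get the value `ab` in all
  -- coordinates, while a non-edge loses it in a colouring that gives both ends the same colour.
  refine ⟨{c : S.carrier → Bool // ∀ x y, x * y + m = m → c x ≠ c y}, fun _ => ab,
    fun x c => if x + m = m then ab else if c.1 x then a else b, h.triple_not_le hu,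
    fun x y z hxyz => ?_, Sc.pi_add_eq_iff ab_ne_zero, fun x => ?_, fun x y => ?_⟩
  -- Some coordinate must exist, since in an empty power every element equals `θ`; the non-edge from
  -- `u` to itself supplies a colouring.
  · obtain ⟨c, hc, -⟩ := hcol u u (h.sq_not_le hu u)
    exact mul_mul_ne _ _ _ (congrFun hxyz ⟨c, hc⟩)
  · by_cases hx : x + m = m
    · simp [hx]
    · simp only [hx, if_false, iff_false]
      obtain ⟨c, hc, -⟩ := hcol u u (h.sq_not_le hu u)
      intro h1
      have h2 := congrFun h1 ⟨c, hc⟩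
      dsimp only at h2
      split_ifs at h2
      · exact a_ne_ab h2
      · exact b_ne_ab h2
  · constructor
    · intro h1
      by_contra hxy
      obtain ⟨c, hc, hcxy⟩ := hcol x y hxy
      have h2 := (mul_eq_ab_iff _ _).1 (congrFun h1 ⟨c, hc⟩)
      dsimp only at h2
      simp only [hcxy] at h2
      split_ifs at h2 <;>
        simp [a_ne_b, a_ne_b.symm, a_ne_ab.symm, b_ne_ab.symm] at h2
    · intro hxy
      funext c
      have h1 := c.2 x y hxy
      have h2 := h.not_le_of_mul_le hu hxy
      have h3 := h.not_le_of_mul_le hu (h.mul_le_comm hxy)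
      change (if x + m = m then ab else if c.1 x then a else b) *
        (if y + m = m then ab else if c.1 y then a else b) = ab
      rw [if_neg h2, if_neg h3]
      revert h1
      cases c.1 x <;> cases c.1 y <;> simp [a_mul_b, b_mul_a]

/-! ### Recovering S_c(a), S_c(ab) and SR6 from failures of identities. -/

theorem ScA.le_of_not_subsingleton {V : AIVariety.{u}} {S : AIAlg.{u}} (hS : S ∈ V.mem)
    (h : AISemiring.SR6Laws S.carrier) (hne : ¬ Subsingleton S.carrier) :
    AIVariety.generatedBy.{u} ScA ≤ V := by
  -- If every element were its own square, all would equal the greatest element. The bound used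
  -- below is `p` itself.
  obtain ⟨p, hp⟩ : ∃ p : S.carrier, p ≠ p * p := by
    by_contra hall
    push Not at hall
    exact hne ⟨fun x y => by rw [hall x, hall y, h.sq_eq_sq]⟩
  have hu : p * p + p ≠ p := fun h1 => hp (h.eq_sq_of_sq_le h1 p)
  have hprod : ∀ x y : ScA, x * y ≠ a := fun x y hxy =>
    a_ne_zero (hxy.symm.trans (mul_eq_zero _ _))
  obtain ⟨f, -, hf⟩ := AISub.exists_hom_closure (v := fun _ : Unit => p) rfl
    (fun _ : Unit => a) (AITerm.eval_congr_of_separated (m := p) (θ := a)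
      (h.triple_not_le hu) (fun x y z => hprod _ _) (fun x y => Sc.add_eq_iff a_ne_zero)
      (fun _ => iff_of_true rfl (AISemiring.add_idem p)) (fun _ _ => iff_of_false (hprod _ _) hu)
      (by
        intro x y hxy _
        rcases eq_zero_or x with rfl | rfl <;> rcases eq_zero_or y with rfl | rfl <;>
          simp_all [a_ne_zero.symm]))
  refine AIVariety.generatedBy_le_of_hom hS _ f (hf fun y => ?_)
  rcases eq_zero_or y with rfl | rfl
  · exact ⟨(AITerm.var ()).mul (.var ()), mul_eq_zero _ _⟩
  · exact ⟨.var (), rfl⟩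

/-- Take m = pq, which is not greatest because it differs from a square. Then p and q form an edge
below m, just as a and b do below ab. The elements are separated since ab is the target itself, a
and b are the unique partners of b and a with product ab, and 0 has none. -/
theorem ScAB.exists_hom {S : Type*} [AISemiring S] (h : AISemiring.SR6Laws S) {p q : S}
    (hpq : p * p ≠ p * q) :
    ∃ f : AIHom (AISub.closure {p, q}) ScAB, Function.Surjective f ∧
      f ⟨p, AISub.subset_closure (by simp)⟩ = a ∧ f ⟨q, AISub.subset_closure (by simp)⟩ = b := by
  have hu : p * p + p * q ≠ p * q := fun h1 => hpq (h.eq_sq_of_sq_le h1 p).symm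
  have hle := AISemiring.add_idem (p * q)
  have hp := h.not_le_of_mul_le hu hle
  have hq := h.not_le_of_mul_le hu (h.mul_le_comm hle)
  have hsq := h.sq_not_le hu
  obtain ⟨f, hf, hf'⟩ := AISub.exists_hom_closure (v := ![p, q]) (Y := {p, q})
    (by simp [Set.pair_comm]) ![a, b] (AITerm.eval_congr_of_separated (m := p * q) (θ := ab)
      (h.triple_not_le hu) mul_mul_ne (fun x y => Sc.add_eq_iff ab_ne_zero)
      (by
        intro i
        fin_cases i
        · exact iff_of_false a_ne_ab hp
        · exact iff_of_false b_ne_ab hq)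
      (by
        intro i j
        fin_cases i <;> fin_cases j
        · exact iff_of_false (a_mul_a.trans_ne ab_ne_zero.symm) (hsq p)
        · exact iff_of_true a_mul_b hle
        · exact iff_of_true b_mul_a (h.mul_le_comm hle)
        · exact iff_of_false (b_mul_b.trans_ne ab_ne_zero.symm) (hsq q))
      (by
        intro x y h0 h1
        have h2 := h1 0
        have h3 := h1 1
        simp only [Matrix.cons_val_zero, Matrix.cons_val_one, mul_eq_ab_iff, a_ne_b,
          a_ne_b.symm, and_true, and_false, or_false, false_or] at h2 h3
        rcases cases x with rfl | rfl | rfl | rfl <;> rcases cases y with rfl | rfl | rfl | rfl <;>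
          simp_all [a_ne_zero.symm, b_ne_zero.symm, ab_ne_zero.symm]))
  refine ⟨f, hf' fun y => ?_, hf (.var 0) _, hf (.var 1) _⟩
  rcases cases y with rfl | rfl | rfl | rfl
  · exact ⟨(AITerm.var 0).mul (.var 0), a_mul_a⟩
  · exact ⟨.var 0, rfl⟩
  · exact ⟨.var 1, rfl⟩
  · exact ⟨(AITerm.var 0).mul (.var 1), a_mul_b⟩

namespace SR6

theorem add_eq_s3_iff (x y : SR6) : x + y = s3 ↔ x = s3 ∧ y = s3 := by
  constructor
  · cases x <;> cases y <;> intro h <;> first | exact ⟨rfl, rfl⟩ | cases h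
  · rintro ⟨rfl, rfl⟩
    rfl

theorem mul_mul_ne (x y z : SR6) : x * y * z ≠ s3 := by
  intro h
  cases x <;> cases y <;> cases z <;> cases h

/-- Products equal to 3 make 2, 6, 5, 4 a path, whose vertices have the distinct neighbourhoods {6},
{2, 5}, {6, 4}, {5}. The elements 1 and 3 have no neighbours, and equality with 3 tells them apart.
-/
theorem eq_of_mul_eq_s3_iff {x y : SR6} (h0 : x = s3 ↔ y = s3)
    (h : ∀ i, x * ![s2, s6, s5, s4] i = s3 ↔ y * ![s2, s6, s5, s4] i = s3) : x = y := by
  have h13 : s1 ≠ s3 := nofun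
  have key : ∀ {u v : SR6}, (u = s3 ↔ v = s3) → ¬ (u = s3 ∧ v = s1) ∧ ¬ (u = s1 ∧ v = s3) := by
    intro u v huv
    constructor
    · rintro ⟨h1, h2⟩
      exact h13 (h2.symm.trans (huv.1 h1))
    · rintro ⟨h1, h2⟩
      exact h13 (h1.symm.trans (huv.2 h2))
  have k2 := key (h 0)
  have k6 := key (h 1)
  have k5 := key (h 2)
  have k4 := key (h 3)
  cases x <;> cases y <;> first
    | rfl
    | exact absurd (h0.1 rfl) nofun
    | exact absurd (h0.2 rfl) nofun
    | exact absurd ⟨rfl, rfl⟩ k2.1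
    | exact absurd ⟨rfl, rfl⟩ k2.2
    | exact absurd ⟨rfl, rfl⟩ k6.1
    | exact absurd ⟨rfl, rfl⟩ k6.2
    | exact absurd ⟨rfl, rfl⟩ k5.1
    | exact absurd ⟨rfl, rfl⟩ k5.2
    | exact absurd ⟨rfl, rfl⟩ k4.1
    | exact absurd ⟨rfl, rfl⟩ k4.2

theorem range_four {S : Type*} (p q r s : S) : Set.range ![p, q, r, s] = {p, q, r, s} := by
  ext x
  simp only [Matrix.range_cons, Matrix.range_empty, Set.mem_union, Set.mem_singleton_iff,
    Set.mem_insert_iff, Set.mem_empty_iff_false]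
  tauto

theorem exists_hom {S : Type*} [AISemiring S] (h : AISemiring.SR6Laws S) {p q r s : S}
    (hps : p * s + (p * q + q * r + r * s) ≠ p * q + q * r + r * s) :
    ∃ f : AIHom (AISub.closure {p, q, r, s}) SR6, Function.Surjective f ∧
      f ⟨p, AISub.subset_closure (by simp)⟩ = s2 ∧ f ⟨q, AISub.subset_closure (by simp)⟩ = s6 ∧
      f ⟨r, AISub.subset_closure (by simp)⟩ = s5 ∧
      f ⟨s, AISub.subset_closure (by simp)⟩ = s4 := by
  -- Below `m` the graph on the generators is exactly the path p, q, r, s: `hps` excludes the edge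
  -- ps, and the absence of triangles excludes pr and qs.
  generalize hm : p * q + q * r + r * s = m at hps
  have hmm := AISemiring.add_idem m
  nth_rw 1 [← hm] at hmm
  rw [AISemiring.add_add_eq_iff, AISemiring.add_add_eq_iff] at hmm
  obtain ⟨⟨hpq, hqr⟩, hrs⟩ := hmm
  have hqp := h.mul_le_comm hpq
  have hrq := h.mul_le_comm hqr
  have hsr := h.mul_le_comm hrs
  have hsp : s * p + m ≠ m := fun h1 => hps (h.mul_le_comm h1)
  have hpr := h.mul_not_le_of_path hps hpq hqr
  have hrp := h.mul_not_le_of_path hps hrq hqp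
  have hqs := h.mul_not_le_of_path hps hqr hrs
  have hsq := h.mul_not_le_of_path hps hsr hrq
  have sq := h.sq_not_le hps
  have h13 : s1 ≠ s3 := nofun
  obtain ⟨f, hf, hf'⟩ := AISub.exists_hom_closure (range_four p q r s) ![s2, s6, s5, s4]
    (AITerm.eval_congr_of_separated (m := m) (θ := s3)
      (h.triple_not_le hps) mul_mul_ne add_eq_s3_iff
      (by
        intro i
        fin_cases i
        · exact iff_of_false nofun (h.not_le_of_mul_le hps hpq)
        · exact iff_of_false nofun (h.not_le_of_mul_le hps hqr)
        · exact iff_of_false nofun (h.not_le_of_mul_le hps hrs)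
        · exact iff_of_false nofun (h.not_le_of_mul_le hps hsr))
      (by
        intro i j
        fin_cases i <;> fin_cases j
        · exact iff_of_false h13 (sq p)
        · exact iff_of_true rfl hpq
        · exact iff_of_false h13 hpr
        · exact iff_of_false h13 hps
        · exact iff_of_true rfl hqp
        · exact iff_of_false h13 (sq q)
        · exact iff_of_true rfl hqr
        · exact iff_of_false h13 hqs
        · exact iff_of_false h13 hrp
        · exact iff_of_true rfl hrq
        · exact iff_of_false h13 (sq r)
        · exact iff_of_true rfl hrs
        · exact iff_of_false h13 hsp
        · exact iff_of_false h13 hsq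
        · exact iff_of_true rfl hsr
        · exact iff_of_false h13 (sq s))
      fun _ _ => eq_of_mul_eq_s3_iff)
  refine ⟨f, hf' fun y => ?_, hf (.var 0) _, hf (.var 1) _, hf (.var 2) _, hf (.var 3) _⟩
  cases y
  · exact ⟨(AITerm.var 0).mul (.var 0), rfl⟩
  · exact ⟨.var 0, rfl⟩
  · exact ⟨(AITerm.var 0).mul (.var 1), rfl⟩
  · exact ⟨.var 3, rfl⟩
  · exact ⟨.var 2, rfl⟩
  · exact ⟨.var 1, rfl⟩

/-! ### The bound 86 for subalgebras with four generators. -/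

/-- Ten flags, for the letters `p, q, r, s` and the edges `pq, pr, ps, qr, qs, rs`: either all are
set, or some are, no edge contains a letter that is set, and there is no triangle. -/
def IsCode : Bool × Bool × Bool × Bool × Bool × Bool × Bool × Bool × Bool × Bool → Prop
  | (p, q, r, s, pq, pr, ps, qr, qs, rs) =>
    (p ∧ q ∧ r ∧ s ∧ pq ∧ pr ∧ ps ∧ qr ∧ qs ∧ rs) ∨
    ((p ∨ q ∨ r ∨ s ∨ pq ∨ pr ∨ ps ∨ qr ∨ qs ∨ rs) ∧
      ¬ (p ∧ (pq ∨ pr ∨ ps)) ∧ ¬ (q ∧ (pq ∨ qr ∨ qs)) ∧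
      ¬ (r ∧ (pr ∨ qr ∨ rs)) ∧ ¬ (s ∧ (ps ∨ qs ∨ rs)) ∧
      ¬ (pq ∧ qr ∧ pr) ∧ ¬ (pq ∧ qs ∧ ps) ∧ ¬ (pr ∧ rs ∧ ps) ∧ ¬ (qr ∧ rs ∧ qs))

instance : DecidablePred IsCode
  | (p, q, r, s, pq, pr, ps, qr, qs, rs) => by
    unfold IsCode
    infer_instance

/-- Sum 2 to the number of isolated vertices over the triangle-free graphs on four labelled
vertices, by number of edges: 16 + 24 + (24 + 3) + 16 + 3 = 86. The code without flags drops out and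
the code with all flags comes in. -/
theorem card_isCode : (Finset.univ.filter IsCode).card = 86 := by decide +kernel

open Classical in
/-- The flags of the words in `p, q, r, s` that lie below `x`. -/
noncomputable def code {S : Type*} [AISemiring S] (p q r s x : S) :
    Bool × Bool × Bool × Bool × Bool × Bool × Bool × Bool × Bool × Bool :=
  (decide (p + x = x), decide (q + x = x), decide (r + x = x), decide (s + x = x),
    decide (p * q + x = x), decide (p * r + x = x), decide (p * s + x = x),
    decide (q * r + x = x), decide (q * s + x = x), decide (r * s + x = x))

end SR6

namespace AITerm

variable {X S : Type*} [AISemiring S]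

/-- This rules out the code without flags. A product of three elements is greatest, so any letter
lies below it. -/
theorem exists_word_le [Nonempty X] (h : AISemiring.SR6Laws S) (v : X → S) (t : AITerm X) :
    (∃ i, v i + t.eval v = t.eval v) ∨ ∃ i j, v i * v j + t.eval v = t.eval v := by
  refine eval_induction v v (Q := fun x _ => (∃ i, v i + x = x) ∨ ∃ i j, v i * v j + x = x)
    ?_ ?_ ?_ ?_ t
  · exact fun i => Or.inl ⟨i, AISemiring.add_idem _⟩
  · exact fun i j => Or.inr ⟨i, j, AISemiring.add_idem _⟩
  · intro a b c _ _ _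
    exact Or.inl ⟨Classical.arbitrary X, by rw [h.triple, h.add_sq]⟩
  · rintro a b _ _ (⟨i, hi⟩ | ⟨i, j, hi⟩) _
    · exact Or.inl ⟨i, by rw [← add_assoc, hi]⟩
    · exact Or.inr ⟨i, j, by rw [← add_assoc, hi]⟩

/-- An element generated by `v` is the supremum of the words of length at most two below it. -/
theorem eval_le_of_words [Nonempty X] (h : AISemiring.SR6Laws S) (v : X → S) (t : AITerm X) (z : S)
    (h1 : ∀ i, v i + t.eval v = t.eval v → v i + z = z)
    (h2 : ∀ i j, v i * v j + t.eval v = t.eval v → v i * v j + z = z) : t.eval v + z = z := by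
  refine eval_induction v v (Q := fun x _ => (∀ i, v i + x = x → v i + z = z) →
    (∀ i j, v i * v j + x = x → v i * v j + z = z) → x + z = z) ?_ ?_ ?_ ?_ t h1 h2
  · exact fun i h1 _ => h1 i (AISemiring.add_idem _)
  · exact fun i j _ h2 => h2 i j (AISemiring.add_idem _)
  · intro a b c _ _ _ _ h2
    have i := Classical.arbitrary X
    rw [h.triple, h.sq_eq_sq a (v i)]
    exact h2 i i (by rw [h.triple, h.add_sq])
  · intro a b _ _ ha hb h1 h2
    have hl : ∀ {w}, w + a = a → w + (a + b) = a + b := fun hw => by rw [← add_assoc, hw]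
    have hr : ∀ {w}, w + b = b → w + (a + b) = a + b := fun hw => by
      rw [add_left_comm, hw]
    rw [AISemiring.add_add_eq_iff]
    exact ⟨ha (fun i hi => h1 i (hl hi)) fun i j hi => h2 i j (hl hi),
      hb (fun i hi => h1 i (hr hi)) fun i j hi => h2 i j (hr hi)⟩

end AITerm

namespace SR6

variable {S : Type*} [AISemiring S]

theorem isCode_code (h : AISemiring.SR6Laws S) (p q r s : S) (t : AITerm (Fin 4)) :
    IsCode (code p q r s (t.eval ![p, q, r, s])) := by
  have hw := AITerm.exists_word_le h ![p, q, r, s] t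
  generalize t.eval ![p, q, r, s] = x at hw
  simp only [IsCode, code, decide_eq_true_eq]
  by_cases hx : ∀ u, u + x = x
  -- The greatest element has all flags; for any other `x` the flags describe a triangle-free graph
  -- with marked isolated vertices.
  · exact Or.inl ⟨hx _, hx _, hx _, hx _, hx _, hx _, hx _, hx _, hx _, hx _⟩
  obtain ⟨u, hu⟩ := not_forall.1 hx
  have hl : ∀ {y z : S}, z + x = x → z * y + x = x → False := fun h1 h2 =>
    h.not_le_of_mul_le hu h2 h1
  have hr : ∀ {y z : S}, z + x = x → y * z + x = x → False := fun h1 h2 =>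
    h.not_le_of_mul_le hu (h.mul_le_comm h2) h1
  have ht : ∀ {y z w : S}, y * z + x = x → z * w + x = x → y * w + x = x → False :=
    fun h1 h2 => h.mul_not_le_of_path hu h1 h2
  refine Or.inr ⟨?_, ?_, ?_, ?_, ?_, ?_, ?_, ?_, ?_⟩
  · by_contra hno
    simp only [not_or] at hno
    obtain ⟨hp, hq, hr, hs, hpq, hpr, hps, hqr, hqs, hrs⟩ := hno
    rcases hw with ⟨i, hi⟩ | ⟨i, j, hi⟩
    · fin_cases i
      exacts [hp hi, hq hi, hr hi, hs hi]
    · have hsq := h.sq_not_le hu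
      have hi' := h.mul_le_comm hi
      fin_cases i <;> fin_cases j
      exacts [hsq _ hi, hpq hi, hpr hi, hps hi, hpq hi', hsq _ hi, hqr hi, hqs hi, hpr hi',
        hqr hi', hsq _ hi, hrs hi, hps hi', hqs hi', hrs hi', hsq _ hi]
  · rintro ⟨h1, h2 | h2 | h2⟩
    exacts [hl h1 h2, hl h1 h2, hl h1 h2]
  · rintro ⟨h1, h2 | h2 | h2⟩
    exacts [hr h1 h2, hl h1 h2, hl h1 h2]
  · rintro ⟨h1, h2 | h2 | h2⟩
    exacts [hr h1 h2, hr h1 h2, hl h1 h2]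
  · rintro ⟨h1, h2 | h2 | h2⟩
    exacts [hr h1 h2, hr h1 h2, hr h1 h2]
  all_goals exact fun ⟨h1, h2, h3⟩ => ht h1 h2 h3

theorem le_of_code_eq (h : AISemiring.SR6Laws S) {p q r s z : S} (t : AITerm (Fin 4))
    (hc : code p q r s (t.eval ![p, q, r, s]) = code p q r s z) :
    t.eval ![p, q, r, s] + z = z := by
  have key := AITerm.eval_le_of_words h ![p, q, r, s] t z
  generalize t.eval ![p, q, r, s] = x at hc key
  simp only [code, Prod.mk.injEq, decide_eq_decide] at hc
  obtain ⟨hp, hq, hr, hs, hpq, hpr, hps, hqr, hqs, hrs⟩ := hc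
  have hsymm : ∀ {y w : S}, (y * w + x = x ↔ y * w + z = z) → w * y + x = x → w * y + z = z :=
    fun h1 h2 => h.mul_le_comm (h1.1 (h.mul_le_comm h2))
  -- Squares have no flag of their own. If one lies below `x`, then `x` is greatest and has all
  -- flags, so p and pq lie below `z`, and their sum is the greatest element.
  have hsq : ∀ {y : S}, y * y + x = x → y * y + z = z := by
    intro y hy
    have hx : ∀ u, u + x = x := fun u => by rw [h.eq_sq_of_sq_le hy y, h.add_sq]
    rw [h.sq_eq_sq y p, ← h.add_mul p q, AISemiring.add_add_eq_iff]
    exact ⟨hp.1 (hx _), hpq.1 (hx _)⟩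
  refine key (fun i => ?_) fun i j => ?_
  · fin_cases i
    exacts [hp.1, hq.1, hr.1, hs.1]
  · fin_cases i <;> fin_cases j
    exacts [hsq, hpq.1, hpr.1, hps.1, hsymm hpq, hsq, hqr.1, hqs.1, hsymm hpr, hsymm hqr, hsq,
      hrs.1, hsymm hps, hsymm hqs, hsymm hrs, hsq]

theorem closure_finite_and_ncard_le (h : AISemiring.SR6Laws S) (p q r s : S) :
    (AISub.closure {p, q, r, s}).carrier.Finite ∧
      (AISub.closure {p, q, r, s}).carrier.ncard ≤ 86 := by
  have hY := (range_four p q r s).symm.subset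
  have hmaps : Set.MapsTo (code p q r s) (AISub.closure {p, q, r, s}).carrier
      (Finset.univ.filter IsCode : Finset _) := by
    intro x hx
    obtain ⟨t, rfl⟩ := AISub.exists_eval_of_mem_closure hY hx
    simpa using isCode_code h p q r s t
  have hinj : Set.InjOn (code p q r s) (AISub.closure {p, q, r, s}).carrier := by
    intro x hx y hy hxy
    obtain ⟨t, rfl⟩ := AISub.exists_eval_of_mem_closure hY hx
    obtain ⟨t', rfl⟩ := AISub.exists_eval_of_mem_closure hY hy
    exact (le_of_code_eq h t' hxy.symm).symm.trans
      ((add_comm _ _).trans (le_of_code_eq h t hxy))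
  have hfin := Finset.finite_toSet (Finset.univ.filter IsCode)
  refine ⟨Set.Finite.of_injOn hmaps hinj hfin, ?_⟩
  rw [← card_isCode, ← Set.ncard_coe_finset]
  exact Set.ncard_le_ncard_of_injOn _ hmaps hinj hfin

end SR6

/-! ### Dichotomies for subvarieties and the four-element chain. -/

theorem ScA.mem_iff {S : AIAlg.{u}} (hS : S ∈ (AIVariety.generatedBy.{u} SR6).mem) :
    S ∈ (AIVariety.generatedBy.{u} ScA).mem ↔ ∀ x y : S.carrier, x * x = x * y := by
  refine ⟨fun h x y => ?_, ScA.mem_of_laws (SR6.laws_of_mem hS)⟩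
  exact AIVariety.identity_of_mem (A := ScA) (X := Fin 2) (s := (AITerm.var 0).mul (.var 0))
    (t := (AITerm.var 0).mul (.var 1))
    (fun v => (mul_eq_zero _ _).trans (mul_eq_zero _ _).symm) h ![x, y]

theorem ScAB.mem_iff {S : AIAlg.{u}} (hS : S ∈ (AIVariety.generatedBy.{u} SR6).mem) :
    S ∈ (AIVariety.generatedBy.{u} ScAB).mem ↔ ∀ x y z w : S.carrier,
      x * w + (x * y + y * z + z * w) = x * y + y * z + z * w := by
  refine ⟨fun h x y z w => ?_, ScAB.mem_of_laws (SR6.laws_of_mem hS)⟩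
  let path : AITerm (Fin 4) := (((AITerm.var 0).mul (.var 1)).add ((AITerm.var 1).mul (.var 2))).add
    ((AITerm.var 2).mul (.var 3))
  exact AIVariety.identity_of_mem (A := ScAB)
    (s := ((AITerm.var 0).mul (.var 3)).add path) (t := path)
    (fun v => path_inequality (v 0) (v 1) (v 2) (v 3)) h ![x, y, z, w]

namespace AIVariety

theorem eq_trivial_or_scA_le {V : AIVariety.{u}} (hV : V ≤ generatedBy.{u} SR6) :
    V = trivial ∨ generatedBy ScA ≤ V := by
  by_cases h : ∀ S ∈ V.mem, Subsingleton S.carrier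
  · exact Or.inl (le_antisymm h (trivial_le V))
  · push Not at h
    obtain ⟨S, hS, hne⟩ := h
    exact Or.inr (ScA.le_of_not_subsingleton hS (SR6.laws_of_mem (hV hS))
      (not_subsingleton_iff_nontrivial.2 hne))

theorem le_scA_or_scAB_le {V : AIVariety.{u}} (hV : V ≤ generatedBy.{u} SR6) :
    V ≤ generatedBy ScA ∨ generatedBy ScAB ≤ V := by
  by_cases h : ∀ S ∈ V.mem, ∀ x y : S.carrier, x * x = x * y
  · exact Or.inl fun S hS => (ScA.mem_iff (hV hS)).2 (h S hS)
  · push Not at h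
    obtain ⟨S, hS, p, q, hpq⟩ := h
    obtain ⟨f, hf, -⟩ := ScAB.exists_hom (SR6.laws_of_mem (hV hS)) hpq
    exact Or.inr (generatedBy_le_of_hom hS _ f hf)

theorem le_scAB_or_eq {V : AIVariety.{u}} (hV : V ≤ generatedBy.{u} SR6) :
    V ≤ generatedBy ScAB ∨ V = generatedBy SR6 := by
  by_cases h : ∀ S ∈ V.mem, ∀ x y z w : S.carrier,
      x * w + (x * y + y * z + z * w) = x * y + y * z + z * w
  · exact Or.inl fun S hS => (ScAB.mem_iff (hV hS)).2 (h S hS)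
  · push Not at h
    obtain ⟨S, hS, p, q, r, s, hpqrs⟩ := h
    obtain ⟨f, hf, -⟩ := SR6.exists_hom (SR6.laws_of_mem (hV hS)) hpqrs
    exact Or.inr (le_antisymm hV (generatedBy_le_of_hom hS _ f hf))

theorem not_sr6_le_scAB : ¬ generatedBy.{u} SR6 ≤ generatedBy ScAB := by
  rw [generatedBy_le_iff]
  intro h
  -- In SR6 the products 2·6, 6·5 and 5·4 are all 3, but 2·4 = 1 is not below 3.
  have h1 := congrArg ULift.down ((ScAB.mem_iff (mem_generatedBy SR6)).1 h
    ⟨SR6.s2⟩ ⟨SR6.s6⟩ ⟨SR6.s5⟩ ⟨SR6.s4⟩)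
  exact (show SR6.s1 ≠ SR6.s3 from nofun) h1

theorem scAB_le_sr6 : generatedBy.{u} ScAB ≤ generatedBy SR6 := by
  -- The dichotomy is applied to V(SR6) itself: 2·2 = 1 and 2·6 = 3 violate the identity of S_c(a),
  -- so no explicit copy of S_c(ab) is needed.
  refine (le_scA_or_scAB_le le_rfl).resolve_left fun h => ?_
  have h1 := congrArg ULift.down ((ScA.mem_iff (mem_generatedBy SR6)).1
    (h (mem_generatedBy SR6)) ⟨SR6.s2⟩ ⟨SR6.s6⟩)
  exact (show SR6.s1 ≠ SR6.s3 from nofun) h1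

theorem trivial_lt_scA : trivial < generatedBy.{u} ScA := by
  refine lt_of_le_of_ne (trivial_le _) fun h => ?_
  have h1 : Subsingleton (ULift.{u} ScA) := h.symm.le (mem_generatedBy ScA)
  exact ScA.a_ne_zero (congrArg ULift.down (h1.elim ⟨ScA.a⟩ ⟨Sc.zero⟩))

theorem not_scAB_le_scA : ¬ generatedBy.{u} ScAB ≤ generatedBy ScA := by
  rw [generatedBy_le_iff]
  intro h
  have h1 := congrArg ULift.down ((ScA.mem_iff (scAB_le_sr6 (mem_generatedBy ScAB))).1 h
    ⟨ScAB.a⟩ ⟨ScAB.b⟩)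
  exact ScAB.ab_ne_zero (ScAB.a_mul_b.symm.trans (h1.symm.trans ScAB.a_mul_a))

theorem scA_lt_scAB : generatedBy.{u} ScA < generatedBy ScAB := by
  refine lt_of_le_not_ge ((eq_trivial_or_scA_le scAB_le_sr6).resolve_left fun h => ?_)
    not_scAB_le_scA
  exact not_scAB_le_scA (h.le.trans (trivial_le _))

theorem scAB_lt_sr6 : generatedBy.{u} ScAB < generatedBy SR6 :=
  lt_of_le_not_ge scAB_le_sr6 not_sr6_le_scAB

theorem eq_of_le_sr6 {V : AIVariety.{u}} (hV : V ≤ generatedBy.{u} SR6) :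
    V = trivial ∨ V = generatedBy ScA ∨ V = generatedBy ScAB ∨ V = generatedBy SR6 := by
  rcases eq_trivial_or_scA_le hV with h1 | h1
  · exact Or.inl h1
  rcases le_scA_or_scAB_le hV with h2 | h2
  · exact Or.inr (Or.inl (le_antisymm h2 h1))
  rcases le_scAB_or_eq hV with h3 | h3
  · exact Or.inr (Or.inr (Or.inl (le_antisymm h3 h2)))
  · exact Or.inr (Or.inr (Or.inr h3))

/-- The four subvarieties of `V(SR6)` in increasing order. -/
noncomputable def chain : Fin 4 → Set.Iic (generatedBy.{u} SR6) :=
  ![⟨trivial, trivial_le _⟩, ⟨generatedBy ScA, scA_lt_scAB.le.trans scAB_le_sr6⟩,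
    ⟨generatedBy ScAB, scAB_le_sr6⟩, ⟨generatedBy SR6, Set.mem_Iic.2 le_rfl⟩]

theorem chain_strictMono : StrictMono chain.{u} := by
  rw [Fin.strictMono_iff_lt_succ]
  intro i
  fin_cases i
  exacts [trivial_lt_scA, scA_lt_scAB, scAB_lt_sr6]

theorem chain_surjective : Function.Surjective chain.{u} := by
  rintro ⟨V, hV⟩
  rcases eq_of_le_sr6 hV with rfl | rfl | rfl | rfl
  exacts [⟨0, rfl⟩, ⟨1, rfl⟩, ⟨2, rfl⟩, ⟨3, rfl⟩]

theorem minimal_iff (V : AIVariety.{u}) :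
    Minimal (fun U => U ≤ generatedBy SR6 ∧ U ≠ trivial) V ↔ V = generatedBy ScA := by
  have hmem : generatedBy.{u} ScA ≤ generatedBy SR6 ∧ generatedBy.{u} ScA ≠ trivial :=
    ⟨scA_lt_scAB.le.trans scAB_le_sr6, trivial_lt_scA.ne'⟩
  constructor
  · intro h
    have h1 := (eq_trivial_or_scA_le h.prop.1).resolve_left h.prop.2
    exact le_antisymm (h.le_of_le hmem h1) h1
  · rintro rfl
    exact ⟨hmem, fun U hU _ => (eq_trivial_or_scA_le hU.1).resolve_left hU.2⟩

end AIVariety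

theorem mainTheorem4 :
    -- the subvariety lattice of `V(SR6)` is the chain `T < V(S_c(a)) < V(S_c(ab)) < V(SR6)`
    (∃ e : Fin 4 ≃o Set.Iic (AIVariety.generatedBy.{u} SR6),
      (e 0 : AIVariety.{u}) = AIVariety.trivial ∧
      (e 1 : AIVariety.{u}) = AIVariety.generatedBy ScA ∧
      (e 2 : AIVariety.{u}) = AIVariety.generatedBy ScAB ∧
      (e 3 : AIVariety.{u}) = AIVariety.generatedBy SR6) ∧
    -- `V(S_c(a))` is the unique minimal nontrivial subvariety of `V(SR6)`
    (∀ V : AIVariety.{u},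
      Minimal (fun U => U ≤ AIVariety.generatedBy SR6 ∧ U ≠ AIVariety.trivial) V ↔
        V = AIVariety.generatedBy ScA) ∧
    -- the identities that define `V(S_c(a))` and `V(S_c(ab))` within `V(SR6)`
    (∀ S ∈ (AIVariety.generatedBy.{u} SR6).mem,
      (S ∈ (AIVariety.generatedBy.{u} ScA).mem ↔ ∀ x y : S.carrier, x * x = x * y) ∧
      (S ∈ (AIVariety.generatedBy.{u} ScAB).mem ↔ ∀ a b c d : S.carrier,
        a * d + (a * b + b * c + c * d) = a * b + b * c + c * d)) ∧
    -- `S_c(ab)` is recovered from any violation of the first identity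
    (∀ S ∈ (AIVariety.generatedBy.{u} SR6).mem, ∀ a b : S.carrier, a * a ≠ a * b →
      ∃ f : AIHom (AISub.closure {a, b}) ScAB, Function.Surjective f ∧
        f ⟨a, AISub.subset_closure (by simp)⟩ = Sc.ofWord {{0, 1}} {0} ∧
        f ⟨b, AISub.subset_closure (by simp)⟩ = Sc.ofWord {{0, 1}} {1}) ∧
    -- `SR6` is recovered from any violation of the second identity
    (∀ S ∈ (AIVariety.generatedBy.{u} SR6).mem, ∀ a b c d : S.carrier,
      a * d + (a * b + b * c + c * d) ≠ a * b + b * c + c * d →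
      (AISub.closure {a, b, c, d}).carrier.Finite ∧
      (AISub.closure {a, b, c, d}).carrier.ncard ≤ 86 ∧
      ∃ f : AIHom (AISub.closure {a, b, c, d}) SR6, Function.Surjective f ∧
        f ⟨a, AISub.subset_closure (by simp)⟩ = SR6.s2 ∧
        f ⟨b, AISub.subset_closure (by simp)⟩ = SR6.s6 ∧
        f ⟨c, AISub.subset_closure (by simp)⟩ = SR6.s5 ∧
        f ⟨d, AISub.subset_closure (by simp)⟩ = SR6.s4) := by
  refine ⟨⟨AIVariety.chain_strictMono.orderIsoOfSurjective _ AIVariety.chain_surjective,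
    rfl, rfl, rfl, rfl⟩, AIVariety.minimal_iff, fun S hS => ⟨ScA.mem_iff hS, ScAB.mem_iff hS⟩,
    fun S hS a b hab => ScAB.exists_hom (SR6.laws_of_mem hS) hab,
    fun S hS a b c d habcd => ?_⟩
  have h := SR6.laws_of_mem hS
  obtain ⟨h1, h2⟩ := SR6.closure_finite_and_ncard_le h a b c d
  exact ⟨h1, h2, SR6.exists_hom h habcd⟩
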